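/- Let $(\mathcal X,\rho)$ be a separable metric space and $\mathcal Y$ a separable Banach space, both with their Borel $\sigma$-algebras, and let $(X,Y)$ be a random pair in $\mathcal X\times\mathcal Y$ with marginal laws $\mu_X,\mu_Y$. Let $\ell:\mathcal Y\times\mathcal Y\to[0,\infty)$ be a measurable loss for which there are finite constants $L$, $c$ and $\alpha>0$ such that for all $y,y',y''\in\mathcal Y$ $$\ell(y,y')\le L,\qquad |\ell(y,y')-\ell(y,y'')|\le c\,\ell(y',y''),\qquad \ell(y,y')\le\|y-y'\|^{\alpha}.$$ For $f:\mathcal X\to\mathcal Y$ put $R(f)=\mathbb E\,\ell(Y,f(X))$, where $(X,Y)$ is independent of $f$ if $f$ is random. Let $m_{Fr}:\mathcal X\to\mathcal Y$ be a conditional Fréchet mean, that is, a measurable function such that for $\mu_X$-almost every $x$ the point $m_{Fr}(x)$ minimizes $y\mapsto\mathbb E[\ell(Y,y)\mid X=x]$ over $\mathcal Y$ (conditional expectations being taken with respect to the regular conditional distribution of $Y$ given $X$), and assume that $m_{Fr}(x)$ lies in the support of $\mu_Y$ for $\mu_X$-almost every $x$. Let $(X_1,Y_1),(X_2,Y_2),\dots$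 be i.i.d. copies of $(X,Y)$, let $X'_1,X'_2,\dots$ be i.i.d. copies of $X$ and $Y'_1,Y'_2,\dots$ i.i.d. copies of $Y$, such that the sequence $(X_i,Y_i)_i$ is independent of $\big((X'_j)_j,(Y'_i)_i\big)$. For $k\ge1$ and $1\le j\le k$ let $$A_{k,j}=\{x\in\mathcal X:\ \rho(x,X'_j)\le\rho(x,X'_i)\text{ for all }i\le k,\ \rho(x,X'_j)<\rho(x,X'_i)\text{ for all }i<j\}$$ be the Voronoi cells of $X'_1,\dots,X'_k$, with ties broken by indices. Assume that ties have probability zero: for all $i\ne j$ and $X$ independent of $(X'_i,X'_j)$, $\mathbb P\{\rho(X,X'_i)=\rho(X,X'_j)\}=0$. For a sequence $(k_n)$ of nonnegative integers and every $n\ge1$ with $k_n\ge1$, let $m_n$ be the function that is constant on each cell $A_{k_n,j}$, $1\le j\le k_n$, with value there $$m_n(x)\in\operatorname*{arg\,min}_{y\in\{Y'_1,\dots,Y'_n\}}\ \sum_{i=1}^n\ell(Y_i,y)\,\mathbb I_{\{X_i\in A_{k_n,j}\}},\qquad x\in A_{k_n,j},$$ where any choice among several minimizers is allowed. If $k_n\to\infty$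 and $k_n\ln n/n\to0$, then $$\lim_{n\to\infty}R(m_n)=R(m_{Fr})\qquad\text{almost surely.}$$ -/

import Mathlib

open MeasureTheory ProbabilityTheory Filter Topology

namespace ProtoNN

variable {𝓧 𝓨 : Type*}

/-- The Voronoi cell of the nucleus `c j` for the nuclei `c 0, …, c (k - 1)`: the points whose
nearest nucleus is `c j`, where a tie is broken in favour of the smaller index. -/
def voronoiCell [MetricSpace 𝓧] {k : ℕ} (c : Fin k → 𝓧) (j : Fin k) : Set 𝓧 :=
  {x | (∀ i, dist x (c j) ≤ dist x (c i)) ∧ ∀ i, i < j → dist x (c j) < dist x (c i)}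

/-- The empirical loss `∑ ℓ(Yᵢ, v) 𝟙{Xᵢ ∈ A}` of the constant prediction `v` on the set `A`, for
the labeled sample `(x 0, y 0), …, (x (n - 1), y (n - 1))`. -/
noncomputable def cellLoss (ℓ : 𝓨 → 𝓨 → ℝ) {n : ℕ} (x : Fin n → 𝓧) (y : Fin n → 𝓨)
    (A : Set 𝓧) (v : 𝓨) : ℝ :=
  ∑ i, A.indicator (fun _ => ℓ (y i) v) (x i)

/-- `f` is a version of the estimate built from the labeled sample `(x i, y i)`, the nuclei `x'`
and the output prototypes `y'`: on each Voronoi cell, `f` is constant, and its value there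
minimizes the empirical loss of the cell over the set of output prototypes. Any choice
among several minimizers is allowed. -/
def IsEstimate [MetricSpace 𝓧] (ℓ : 𝓨 → 𝓨 → ℝ) {n k : ℕ} (x : Fin n → 𝓧) (y : Fin n → 𝓨)
    (x' : Fin k → 𝓧) (y' : Fin n → 𝓨) (f : 𝓧 → 𝓨) : Prop :=
  ∀ j : Fin k, ∃ v ∈ Set.range y',
    (∀ w ∈ Set.range y',
      cellLoss ℓ x y (voronoiCell x' j) v ≤ cellLoss ℓ x y (voronoiCell x' j) w) ∧
    ∀ t ∈ voronoiCell x' j, f t = v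

/-- The risk `R(f) = E ℓ(Y, f(X))`, where `(X, Y)` has law `ν`. -/
noncomputable def risk [MeasurableSpace 𝓧] [MeasurableSpace 𝓨] (ν : Measure (𝓧 × 𝓨))
    (ℓ : 𝓨 → 𝓨 → ℝ) (f : 𝓧 → 𝓨) : ℝ :=
  ∫ p, ℓ p.2 (f p.1) ∂ν

/-- `m` is a (measurable version of the) conditional Fréchet mean: for almost every `x`, the point
`m x` minimizes `y ↦ E[ℓ(Y, y) | X = x]` over the whole space. Here `(X, Y)` has law `ν` and
`ν.condKernel` is the regular conditional distribution of `Y` given `X`. -/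
def IsCondFrechetMean [MeasurableSpace 𝓧] [MeasurableSpace 𝓨] [StandardBorelSpace 𝓨] [Nonempty 𝓨]
    (ν : Measure (𝓧 × 𝓨)) [IsFiniteMeasure ν] (ℓ : 𝓨 → 𝓨 → ℝ) (m : 𝓧 → 𝓨) : Prop :=
  Measurable m ∧ ∀ᵐ x ∂ν.fst, ∀ y : 𝓨,
    ∫ z, ℓ z (m x) ∂(ν.condKernel x) ≤ ∫ z, ℓ z y ∂(ν.condKernel x)

end ProtoNN

/-! The excess risk splits into an estimation and an approximation error, both controlled on one
almost sure event.

Estimation: minimizing the loss cell by cell minimizes the total empirical risk over all functions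
constant on the cells with values among the `Y'` (`IsEstimate.exists_eq_cellwise`). There are at
most `n ^ k n` of these. They depend on the prototypes only, so with the prototypes frozen Hoeffding
applies to each. A union bound and Borel–Cantelli give uniform deviations tending to zero
(`ae_eventually_forall_abs_sum_sub_risk_lt`), because `k n * log n = o(n)` makes `n ^ k n * exp (-a
n)` summable.

Approximation: `mFr` is close to a continuous `g`. Give each cell the output prototype nearest to
the value of `g` at the nucleus. Since the prototypes are dense in the supports, this function has
risk at most that of `mFr` plus `ε` (`eventually_exists_risk_cellwise_le`). No measurable function
has smaller risk than `mFr` (`IsCondFrechetMean.risk_le`), which closes the sandwich. -/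

namespace ProtoNN

/-! ### Voronoi cells and functions constant on them. -/

section Cells

variable {𝓧 𝓨 : Type*} [MetricSpace 𝓧]

lemma exists_mem_voronoiCell {k : ℕ} (hk : 0 < k) (c : Fin k → 𝓧) (x : 𝓧) :
    ∃ j, x ∈ voronoiCell c j := by
  have : Nonempty (Fin k) := ⟨⟨0, hk⟩⟩
  -- The lexicographic order on (distance, index) encodes the tie-breaking rule.
  obtain ⟨j, hj⟩ := Finite.exists_min (fun j => toLex (dist x (c j), j))
  have h : ∀ i, dist x (c j) < dist x (c i) ∨ dist x (c j) = dist x (c i) ∧ j ≤ i := fun i => by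
    simpa [Prod.Lex.toLex_le_toLex] using hj i
  refine ⟨j, fun i => ?_, fun i hi => ?_⟩
  · rcases h i with h | h
    exacts [h.le, h.1.le]
  · rcases h i with h | h
    exacts [h, absurd hi h.2.not_gt]

lemma eq_of_mem_voronoiCell {k : ℕ} {c : Fin k → 𝓧} {x : 𝓧} {i j : Fin k}
    (hi : x ∈ voronoiCell c i) (hj : x ∈ voronoiCell c j) : i = j := by
  rcases lt_trichotomy i j with h | h | h
  · exact absurd (hj.2 i h) (hi.1 j).not_gt
  · exact h
  · exact absurd (hi.2 j h) (hj.1 i).not_gt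

lemma measurableSet_voronoiCell [SecondCountableTopology 𝓧] [MeasurableSpace 𝓧] [BorelSpace 𝓧]
    {k : ℕ} (j : Fin k) :
    MeasurableSet {p : 𝓧 × (Fin k → 𝓧) | p.1 ∈ voronoiCell p.2 j} := by
  have hd : ∀ i, Measurable fun p : 𝓧 × (Fin k → 𝓧) => dist p.1 (p.2 i) := fun i => by fun_prop
  have hset : {p : 𝓧 × (Fin k → 𝓧) | p.1 ∈ voronoiCell p.2 j} =
      (⋂ i, {p | dist p.1 (p.2 j) ≤ dist p.1 (p.2 i)}) ∩
        ⋂ i, ⋂ _ : i < j, {p | dist p.1 (p.2 j) < dist p.1 (p.2 i)} := by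
    ext p
    simp [voronoiCell]
  rw [hset]
  refine (MeasurableSet.iInter fun i => ?_).inter (MeasurableSet.iInter fun i => ?_)
  · exact measurableSet_le (hd j) (hd i)
  · exact MeasurableSet.iInter fun _ => measurableSet_lt (hd j) (hd i)

/-- The function that takes the value `v j` on the Voronoi cell of `c j`. -/
noncomputable def cellwise [AddCommMonoid 𝓨] {k : ℕ} (c : Fin k → 𝓧) (v : Fin k → 𝓨) (x : 𝓧) : 𝓨 :=
  ∑ j, (voronoiCell c j).indicator (fun _ => v j) x

lemma cellwise_of_mem [AddCommMonoid 𝓨] {k : ℕ} {c : Fin k → 𝓧} (v : Fin k → 𝓨) {x : 𝓧}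
    {j : Fin k} (hx : x ∈ voronoiCell c j) : cellwise c v x = v j := by
  rw [cellwise, Finset.sum_eq_single j, Set.indicator_of_mem hx]
  · exact fun i _ hij => Set.indicator_of_notMem (fun hi => hij (eq_of_mem_voronoiCell hi hx)) _
  · simp

/-- Measurability is joint in the point, the nuclei and the values, so that Fubini can be applied
over the prototypes. -/
lemma measurable_cellwise [SecondCountableTopology 𝓧] [MeasurableSpace 𝓧] [BorelSpace 𝓧]
    [AddCommMonoid 𝓨] [MeasurableSpace 𝓨] [MeasurableAdd₂ 𝓨] (k : ℕ) :
    Measurable fun q : 𝓧 × (Fin k → 𝓧) × (Fin k → 𝓨) => cellwise q.2.1 q.2.2 q.1 := by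
  unfold cellwise
  refine Finset.measurable_sum _ fun j _ => ?_
  classical
  simp only [Set.indicator_apply]
  refine Measurable.ite ?_ (by fun_prop) measurable_const
  exact (measurable_fst.prodMk (measurable_fst.comp measurable_snd)) (measurableSet_voronoiCell j)

lemma measurable_cellwise_apply [SecondCountableTopology 𝓧] [MeasurableSpace 𝓧] [BorelSpace 𝓧]
    [AddCommMonoid 𝓨] [MeasurableSpace 𝓨] [MeasurableAdd₂ 𝓨] {k : ℕ} (c : Fin k → 𝓧)
    (v : Fin k → 𝓨) : Measurable (cellwise c v) := by
  have h : Measurable fun x : 𝓧 => (x, c, v) := measurable_id.prodMk measurable_const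
  exact (measurable_cellwise (𝓨 := 𝓨) k).comp h

lemma sum_loss_cellwise [AddCommMonoid 𝓨] (ℓ : 𝓨 → 𝓨 → ℝ) {n k : ℕ} (hk : 0 < k)
    (x : Fin n → 𝓧) (y : Fin n → 𝓨) (c : Fin k → 𝓧) (v : Fin k → 𝓨) :
    ∑ i, ℓ (y i) (cellwise c v (x i)) = ∑ j, cellLoss ℓ x y (voronoiCell c j) (v j) := by
  simp only [cellLoss]
  rw [Finset.sum_comm]
  refine Finset.sum_congr rfl fun i _ => ?_
  obtain ⟨j, hj⟩ := exists_mem_voronoiCell hk c (x i)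
  rw [cellwise_of_mem v hj, Finset.sum_eq_single j, Set.indicator_of_mem hj]
  · exact fun b _ hb => Set.indicator_of_notMem (fun h => hb (eq_of_mem_voronoiCell h hj)) _
  · simp

/-- The cells partition the space, so the empirical risk is a sum of terms each involving one cell
value, and the separate minimizations are a joint one. -/
lemma IsEstimate.exists_eq_cellwise [AddCommMonoid 𝓨] {ℓ : 𝓨 → 𝓨 → ℝ} {n k : ℕ} (hk : 0 < k)
    {x : Fin n → 𝓧} {y : Fin n → 𝓨} {c : Fin k → 𝓧} {z : Fin n → 𝓨} {f : 𝓧 → 𝓨}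
    (hf : IsEstimate ℓ x y c z f) :
    ∃ φ : Fin k → Fin n, f = cellwise c (z ∘ φ) ∧ ∀ ψ : Fin k → Fin n,
      ∑ i, ℓ (y i) (cellwise c (z ∘ φ) (x i)) ≤ ∑ i, ℓ (y i) (cellwise c (z ∘ ψ) (x i)) := by
  choose v hv hmin hval using hf
  choose φ hφ using hv
  refine ⟨φ, funext fun t => ?_, fun ψ => ?_⟩
  · obtain ⟨j, hj⟩ := exists_mem_voronoiCell hk c t
    rw [cellwise_of_mem _ hj, hval j t hj, Function.comp_apply, hφ]
  · simp only [sum_loss_cellwise ℓ hk]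
    refine Finset.sum_le_sum fun j _ => ?_
    rw [Function.comp_apply, hφ]
    exact hmin j _ ⟨ψ j, rfl⟩

end Cells

/-! ### Density of an i.i.d. sample in the support of its law. -/

section Density

/-- A fixed open `U` of positive measure is missed by `n` draws with probability `μ Uᶜ ^ n → 0`. A
countable basis then yields a single null set serving all points of the support. -/
lemma ae_forall_mem_support_exists_dist_lt {Ω E : Type*} [MeasurableSpace Ω] {P : Measure Ω}
    [IsProbabilityMeasure P] [PseudoMetricSpace E] [SecondCountableTopology E] [MeasurableSpace E]
    [OpensMeasurableSpace E] {μ : Measure E} {Z : ℕ → Ω → E} (hlaw : ∀ i, HasLaw (Z i) μ P)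
    (hind : iIndepFun Z P) :
    ∀ᵐ ω ∂P, ∀ z ∈ μ.support, ∀ ε > 0, ∃ i, dist z (Z i ω) < ε := by
  have : IsProbabilityMeasure μ := (hlaw 0).isProbabilityMeasure_iff.1 inferInstance
  have hb := TopologicalSpace.isBasis_countableBasis E
  have key : ∀ U ∈ TopologicalSpace.countableBasis E, ∀ᵐ ω ∂P, 0 < μ U → ∃ i, Z i ω ∈ U := by
    intro U hU
    have hUm : MeasurableSet U := (hb.isOpen hU).measurableSet
    by_cases h0 : 0 < μ U
    swap
    · exact ae_of_all _ fun ω h => absurd h h0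
    have hlt : μ Uᶜ < 1 := by
      rw [prob_compl_eq_one_sub hUm]
      exact ENNReal.sub_lt_self ENNReal.one_ne_top one_ne_zero h0.ne'
    have hle : ∀ n : ℕ, P {ω | ¬ ∃ i, Z i ω ∈ U} ≤ μ Uᶜ ^ n := fun n => by
      calc P {ω | ¬ ∃ i, Z i ω ∈ U} ≤ P (⋂ i ∈ Finset.range n, Z i ⁻¹' Uᶜ) := by
            refine measure_mono fun ω hω => ?_
            simp only [Set.mem_ofPred_eq, not_exists] at hω
            simp [hω]
        _ = ∏ i ∈ Finset.range n, P (Z i ⁻¹' Uᶜ) :=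
            hind.measure_inter_preimage_eq_mul _ (fun i _ => hUm.compl)
        _ = μ Uᶜ ^ n := by
            rw [Finset.prod_congr rfl (g := fun _ => μ Uᶜ)]
            · simp
            · intro i _
              rw [← (hlaw i).map_eq, Measure.map_apply_of_aemeasurable (hlaw i).aemeasurable
                hUm.compl]
    have hz : P {ω | ¬ ∃ i, Z i ω ∈ U} = 0 := le_antisymm
      (ge_of_tendsto' (ENNReal.tendsto_pow_atTop_nhds_zero_of_lt_one hlt) hle) bot_le
    have : ∀ᵐ ω ∂P, ∃ i, Z i ω ∈ U := hz
    filter_upwards [this] with ω h _ using h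
  have := (ae_ball_iff (TopologicalSpace.countable_countableBasis E)).2 key
  filter_upwards [this] with ω hω z hz ε hε
  obtain ⟨U, hU, hzU, hUb⟩ := hb.mem_nhds_iff.1 (Metric.ball_mem_nhds z hε)
  obtain ⟨i, hi⟩ := hω U hU ((Measure.mem_support_iff_forall z).1 hz U
    ((hb.isOpen hU).mem_nhds hzU))
  exact ⟨i, by simpa [dist_comm] using hUb hi⟩

end Density

/-! ### Hoeffding's inequality, freezing, and summability. -/

section Concentration

variable {Ω : Type*} [MeasurableSpace Ω] {P : Measure Ω} [IsProbabilityMeasure P]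

/-- Hoeffding: a variable in `[0, L]` is sub-Gaussian with parameter `(L / 2) ^ 2` once centered;
the two tails give the factor 2. -/
lemma measureReal_abs_sum_sub_ge_le {E : Type*} [MeasurableSpace E] {ν : Measure E}
    {Z : ℕ → Ω → E} (hlaw : ∀ i, HasLaw (Z i) ν P) (hind : iIndepFun Z P) {f : E → ℝ}
    (hf : Measurable f) {L : ℝ} (hL : 0 < L) (h0 : ∀ e, 0 ≤ f e) (h1 : ∀ e, f e ≤ L) (n : ℕ)
    {ε : ℝ} (hε : 0 ≤ ε) :
    P.real {ω | n * ε ≤ |∑ i ∈ Finset.range n, f (Z i ω) - n * ∫ e, f e ∂ν|} ≤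
      2 * Real.exp (-(2 * n * ε ^ 2 / L ^ 2)) := by
  rcases Nat.eq_zero_or_pos n with rfl | hn
  · simp
  have hint : ∀ i, ∫ ω, f (Z i ω) ∂P = ∫ e, f e ∂ν := fun i =>
    (hlaw i).integral_comp hf.aestronglyMeasurable
  have hae : ∀ i, AEMeasurable (fun ω => f (Z i ω)) P := fun i =>
    hf.comp_aemeasurable (hlaw i).aemeasurable
  have hsub : ∀ i, HasSubgaussianMGF (fun ω => f (Z i ω) - ∫ e, f e ∂ν) ((‖L - 0‖₊ / 2) ^ 2) P :=
    fun i => by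
      have := hasSubgaussianMGF_of_mem_Icc (hae i)
        (ae_of_all P fun ω => (⟨h0 (Z i ω), h1 (Z i ω)⟩ : f (Z i ω) ∈ Set.Icc 0 L))
      rwa [hint i] at this
  have hI : iIndepFun (fun i ω => f (Z i ω) - ∫ e, f e ∂ν) P :=
    hind.comp (fun _ e => f e - ∫ e, f e ∂ν) (fun _ => hf.sub_const _)
  have hI' : iIndepFun (fun i ω => -(f (Z i ω) - ∫ e, f e ∂ν)) P :=
    hind.comp (fun _ e => -(f e - ∫ e, f e ∂ν)) (fun _ => (hf.sub_const _).neg)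
  have hnε : 0 ≤ n * ε := by positivity
  have hn' : (0 : ℝ) < n := by exact_mod_cast hn
  have hexp : -(n * ε) ^ 2 / (2 * n * (((‖L - 0‖₊ / 2) ^ 2 : NNReal) : ℝ)) =
      -(2 * n * ε ^ 2 / L ^ 2) := by
    have : ((‖L - 0‖₊ : NNReal) : ℝ) = L := by simp [abs_of_pos hL]
    push_cast [this]
    field_simp
  have b1 := HasSubgaussianMGF.measure_sum_range_ge_le_of_iIndepFun hI (n := n) (fun i _ => hsub i) hnε
  have b2 := HasSubgaussianMGF.measure_sum_range_ge_le_of_iIndepFun hI' (n := n) (fun i _ => (hsub i).neg) hnε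
  rw [hexp] at b1 b2
  refine (measureReal_mono (fun ω hω => ?_)).trans
    ((measureReal_union_le {ω | n * ε ≤ ∑ i ∈ Finset.range n, (f (Z i ω) - ∫ e, f e ∂ν)}
    {ω | n * ε ≤ ∑ i ∈ Finset.range n, -(f (Z i ω) - ∫ e, f e ∂ν)}).trans (by linarith))
  simp only [Set.mem_ofPred_eq, Set.mem_union, Finset.sum_neg_distrib, Finset.sum_sub_distrib,
    Finset.sum_const, Finset.card_range, nsmul_eq_mul] at hω ⊢
  exact le_abs.1 hω

/-- Freezing: by independence and Fubini, a bound valid for each fixed value of `T` survives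
integration over its law. -/
lemma measure_prodMk_mem_le_of_indepFun {A B : Type*} [MeasurableSpace A] [MeasurableSpace B]
    {S : Ω → A} {T : Ω → B} (hS : AEMeasurable S P) (hT : AEMeasurable T P) (h : IndepFun S T P)
    {E : Set (A × B)} (hE : MeasurableSet E) {δ : ENNReal}
    (hδ : ∀ t, P {ω | (S ω, t) ∈ E} ≤ δ) : P {ω | (S ω, T ω) ∈ E} ≤ δ := by
  have := Measure.isProbabilityMeasure_map (μ := P) hS
  have := Measure.isProbabilityMeasure_map (μ := P) hT
  have h1 : P {ω | (S ω, T ω) ∈ E} = P.map (fun ω => (S ω, T ω)) E :=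
    (Measure.map_apply_of_aemeasurable (hS.prodMk hT) hE).symm
  rw [h1, (indepFun_iff_map_prod_eq_prod_map_map hS hT).1 h, Measure.prod_apply_symm hE]
  refine (lintegral_mono (g := fun _ => δ) fun t => ?_).trans (by simp)
  rw [Measure.map_apply_of_aemeasurable hS (measurable_prodMk_right hE)]
  exact hδ t

/-- Write `n ^ k n = exp (k n * log n)`; eventually the exponent is below `a n / 2`, which leaves a
geometric series. -/
lemma summable_pow_mul_exp {k : ℕ → ℕ}
    (hk : Tendsto (fun n : ℕ => (k n : ℝ) * Real.log n / n) atTop (𝓝 0)) {a : ℝ} (ha : 0 < a) :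
    Summable fun n : ℕ => (n : ℝ) ^ k n * (2 * Real.exp (-(a * n))) := by
  have hs : Summable fun n : ℕ => 2 * Real.exp (n * (-(a / 2))) :=
    (Real.summable_exp_nat_mul_iff.2 (by linarith)).mul_left 2
  refine Summable.of_norm_bounded_eventually_nat hs ?_
  filter_upwards [hk.eventually (gt_mem_nhds (half_pos ha)), eventually_ge_atTop 1] with n hn h1
  have hn0 : (0 : ℝ) < n := by exact_mod_cast h1
  rw [div_lt_iff₀ hn0] at hn
  rw [Real.norm_of_nonneg (by positivity), ← Real.exp_log (pow_pos hn0 (k n)), Real.log_pow,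
    mul_left_comm, ← Real.exp_add]
  gcongr
  linarith

end Concentration

/-! ### Uniform law of large numbers over the cellwise functions. -/

section Uniform

lemma ae_eventually_forall_abs_sum_sub_risk_lt {𝓧 𝓨 Ω : Type*}
    [MetricSpace 𝓧] [SecondCountableTopology 𝓧] [MeasurableSpace 𝓧] [BorelSpace 𝓧]
    [AddCommMonoid 𝓨] [MeasurableSpace 𝓨] [MeasurableAdd₂ 𝓨]
    [MeasurableSpace Ω] {P : Measure Ω} [IsProbabilityMeasure P]
    {ν : Measure (𝓧 × 𝓨)} [IsProbabilityMeasure ν]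
    {ℓ : 𝓨 → 𝓨 → ℝ} (hℓ_meas : Measurable (Function.uncurry ℓ))
    (hℓ_nonneg : ∀ y y', 0 ≤ ℓ y y') {L : ℝ} (hL : 0 < L) (hℓ_bdd : ∀ y y', ℓ y y' ≤ L)
    {X : ℕ → Ω → 𝓧} {Y : ℕ → Ω → 𝓨}
    (hXY_law : ∀ i, HasLaw (fun ω => (X i ω, Y i ω)) ν P)
    (hXY_indep : iIndepFun (fun i ω => (X i ω, Y i ω)) P)
    {X' : ℕ → Ω → 𝓧} (hX' : ∀ j, AEMeasurable (X' j) P)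
    {Y' : ℕ → Ω → 𝓨} (hY' : ∀ j, AEMeasurable (Y' j) P)
    (h_indep : IndepFun (fun ω (i : ℕ) => (X i ω, Y i ω))
      (fun ω => (fun j : ℕ => X' j ω, fun i : ℕ => Y' i ω)) P)
    {k : ℕ → ℕ} (hk_log : Tendsto (fun n : ℕ => (k n : ℝ) * Real.log n / n) atTop (𝓝 0)) :
    ∀ᵐ ω ∂P, ∀ ε > 0, ∀ᶠ n : ℕ in atTop, ∀ φ : Fin (k n) → Fin n,
      |∑ i : Fin n, ℓ (Y i ω) (cellwise (fun j : Fin (k n) => X' j ω)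
          (fun j => Y' (φ j) ω) (X i ω)) -
        n * risk ν ℓ (cellwise (fun j : Fin (k n) => X' j ω) (fun j => Y' (φ j) ω))| < n * ε := by
  have hS : AEMeasurable (fun ω (i : ℕ) => (X i ω, Y i ω)) P :=
    aemeasurable_pi_iff.2 fun i => (hXY_law i).aemeasurable
  have hT : AEMeasurable (fun ω => (fun j : ℕ => X' j ω, fun i : ℕ => Y' i ω)) P :=
    (aemeasurable_pi_iff.2 hX').prodMk (aemeasurable_pi_iff.2 hY')
  have hloss : ∀ n (φ : Fin (k n) → Fin n),
      Measurable fun q : ((ℕ → 𝓧) × (ℕ → 𝓨)) × 𝓧 × 𝓨 =>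
        ℓ q.2.2 (cellwise (fun j : Fin (k n) => q.1.1 j) (fun j => q.1.2 (φ j)) q.2.1) := by
    intro n φ
    have h1 : Measurable fun q : ((ℕ → 𝓧) × (ℕ → 𝓨)) × 𝓧 × 𝓨 =>
        (q.2.1, (fun j : Fin (k n) => q.1.1 j), (fun j => q.1.2 (φ j))) := by fun_prop
    exact hℓ_meas.comp (((measurable_snd.comp measurable_snd)).prodMk
      ((measurable_cellwise (𝓨 := 𝓨) (k n)).comp h1))
  have hrisk : ∀ n (φ : Fin (k n) → Fin n),
      Measurable fun t : (ℕ → 𝓧) × (ℕ → 𝓨) =>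
        risk ν ℓ (cellwise (fun j : Fin (k n) => t.1 j) (fun j => t.2 (φ j))) := fun n φ =>
    ((hloss n φ).stronglyMeasurable.integral_prod_right (ν := ν)).measurable
  -- The bad event is a set of pairs (sample, prototypes), the form in which the prototypes can be
  -- frozen.
  let B : ℝ → (n : ℕ) → (Fin (k n) → Fin n) → Set ((ℕ → 𝓧 × 𝓨) × ((ℕ → 𝓧) × (ℕ → 𝓨))) :=
    fun ε n φ => {q | n * ε ≤ |∑ i ∈ Finset.range n,
      ℓ (q.1 i).2 (cellwise (fun j : Fin (k n) => q.2.1 j) (fun j => q.2.2 (φ j)) (q.1 i).1) -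
        n * risk ν ℓ (cellwise (fun j : Fin (k n) => q.2.1 j) (fun j => q.2.2 (φ j)))|}
  have hB : ∀ ε n φ, MeasurableSet (B ε n φ) := by
    intro ε n φ
    have hsum : Measurable fun q : (ℕ → 𝓧 × 𝓨) × ((ℕ → 𝓧) × (ℕ → 𝓨)) => ∑ i ∈ Finset.range n,
        ℓ (q.1 i).2 (cellwise (fun j : Fin (k n) => q.2.1 j) (fun j => q.2.2 (φ j))
          (q.1 i).1) := by
      refine Finset.measurable_sum _ fun i _ => ?_
      have h2 : Measurable fun q : (ℕ → 𝓧 × 𝓨) × ((ℕ → 𝓧) × (ℕ → 𝓨)) => (q.2, q.1 i) := by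
        fun_prop
      exact (hloss n φ).comp h2
    exact measurableSet_le measurable_const
      (_root_.continuous_abs.measurable.comp
        (hsum.sub (((hrisk n φ).comp measurable_snd).const_mul _)))
  have hPB : ∀ ε, 0 < ε → ∀ n φ,
      P {ω | ((fun i : ℕ => (X i ω, Y i ω)), (fun j : ℕ => X' j ω, fun i : ℕ => Y' i ω)) ∈ B ε n φ}
        ≤ ENNReal.ofReal (2 * Real.exp (-(2 * ε ^ 2 / L ^ 2 * n))) := by
    intro ε hε n φ
    refine measure_prodMk_mem_le_of_indepFun hS hT h_indep (hB ε n φ) fun t => ?_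
    rw [← ofReal_measureReal]
    refine ENNReal.ofReal_le_ofReal ?_
    have := measureReal_abs_sum_sub_ge_le hXY_law hXY_indep
      (f := fun p => ℓ p.2 (cellwise (fun j : Fin (k n) => t.1 j) (fun j => t.2 (φ j)) p.1))
      ((hloss n φ).comp measurable_prodMk_left) hL (fun _ => hℓ_nonneg _ _)
      (fun _ => hℓ_bdd _ _) n hε.le
    rwa [show 2 * ε ^ 2 / L ^ 2 * n = 2 * n * ε ^ 2 / L ^ 2 by ring]
  have main : ∀ ε, 0 < ε → ∀ᵐ ω ∂P, ∀ᶠ n : ℕ in atTop, ∀ φ,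
      ((fun i : ℕ => (X i ω, Y i ω)), (fun j : ℕ => X' j ω, fun i : ℕ => Y' i ω)) ∉ B ε n φ := by
    intro ε hε
    have ha : 0 < 2 * ε ^ 2 / L ^ 2 := by positivity
    have hle : ∀ n, P (⋃ φ, {ω | ((fun i : ℕ => (X i ω, Y i ω)),
        (fun j : ℕ => X' j ω, fun i : ℕ => Y' i ω)) ∈ B ε n φ}) ≤
        ENNReal.ofReal ((n : ℝ) ^ k n * (2 * Real.exp (-(2 * ε ^ 2 / L ^ 2 * n)))) := by
      intro n
      refine (measure_iUnion_fintype_le P _).trans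
        ((Finset.sum_le_sum fun φ _ => hPB ε hε n φ).trans ?_)
      rw [Finset.sum_const, Finset.card_univ, Fintype.card_fun, Fintype.card_fin, Fintype.card_fin,
        nsmul_eq_mul, ← Nat.cast_pow, ENNReal.ofReal_mul (Nat.cast_nonneg _),
        ENNReal.ofReal_natCast]
    have hfin := ne_top_of_le_ne_top (summable_pow_mul_exp hk_log ha).tsum_ofReal_ne_top
      (ENNReal.tsum_le_tsum hle)
    filter_upwards [ae_eventually_notMem hfin] with ω hω
    filter_upwards [hω] with n hn φ hφ
    exact hn (Set.mem_iUnion.2 ⟨φ, hφ⟩)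
  -- Countably many tolerances suffice, so that the null set does not depend on `ε`.
  have hall : ∀ᵐ ω ∂P, ∀ q : ℕ, ∀ᶠ n : ℕ in atTop, ∀ φ,
      ((fun i : ℕ => (X i ω, Y i ω)), (fun j : ℕ => X' j ω, fun i : ℕ => Y' i ω)) ∉
        B (1 / ((q : ℝ) + 1)) n φ :=
    ae_all_iff.2 fun q => main _ (by positivity)
  filter_upwards [hall] with ω hω ε hε
  obtain ⟨q, hq⟩ := exists_nat_one_div_lt hε
  filter_upwards [hω q] with n hn φ
  have := hn φ
  simp only [B, Set.mem_ofPred_eq, not_le, Finset.sum_range] at this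
  exact this.trans_le (by gcongr)

end Uniform

/-! ### Continuous approximation and nearest prototypes. -/

section Approximation

/-- Truncation makes `f` integrable. Its truncations have continuous `L¹` approximations with errors
tending to zero, and convergence in measure gives an a.e. convergent subsequence. -/
lemma exists_seq_continuous_tendsto_ae {𝓧 𝓨 : Type*} [MetricSpace 𝓧] [MeasurableSpace 𝓧]
    [BorelSpace 𝓧] [NormedAddCommGroup 𝓨] [NormedSpace ℝ 𝓨] [SecondCountableTopology 𝓨]
    [MeasurableSpace 𝓨] [BorelSpace 𝓨] (μ : Measure 𝓧) [IsFiniteMeasure μ] {f : 𝓧 → 𝓨}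
    (hf : Measurable f) :
    ∃ g : ℕ → 𝓧 → 𝓨, (∀ n, Continuous (g n)) ∧
      ∀ᵐ x ∂μ, Tendsto (fun n => g n x) atTop (𝓝 (f x)) := by
  let F : ℕ → 𝓧 → 𝓨 := fun N => {x | ‖f x‖ ≤ N}.indicator f
  have hFm : ∀ N, Measurable (F N) := fun N =>
    hf.indicator (measurableSet_le hf.norm measurable_const)
  have hF : ∀ N, MemLp (F N) 1 μ := fun N => by
    refine MemLp.of_bound (hFm N).aestronglyMeasurable N (ae_of_all _ fun x => ?_)
    by_cases hx : ‖f x‖ ≤ N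
    · simpa [F, Set.indicator_of_mem (s := {x | ‖f x‖ ≤ N}) hx] using hx
    · simp [F, Set.indicator_of_notMem (s := {x | ‖f x‖ ≤ N}) hx]
  have hFf : ∀ x, ∀ᶠ N in atTop, F N x = f x := fun x => by
    obtain ⟨M, hM⟩ := exists_nat_ge ‖f x‖
    filter_upwards [eventually_ge_atTop M] with N hN
    exact Set.indicator_of_mem (s := {x | ‖f x‖ ≤ N}) (hM.trans (by exact_mod_cast hN)) f
  choose g hg _ using fun N : ℕ => (hF N).exists_boundedContinuous_eLpNorm_sub_le
    ENNReal.one_ne_top (ε := ((N : ENNReal))⁻¹) (by simp)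
  have hmeas : TendstoInMeasure μ (fun N x => F N x - g N x) atTop (fun _ => (0 : 𝓨)) := by
    refine tendstoInMeasure_of_tendsto_eLpNorm one_ne_zero
      (fun N => ((hFm N).aestronglyMeasurable.sub (g N).continuous.aestronglyMeasurable))
      aestronglyMeasurable_const ?_
    refine tendsto_of_tendsto_of_tendsto_of_le_of_le tendsto_const_nhds
      ENNReal.tendsto_inv_nat_nhds_zero (fun _ => bot_le) fun N => ?_
    refine le_trans (le_of_eq ?_) (hg N)
    congr 1
    ext x
    simp
  obtain ⟨ns, hns, hae⟩ := hmeas.exists_seq_tendsto_ae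
  refine ⟨fun n => g (ns n), fun n => (g (ns n)).continuous, ?_⟩
  filter_upwards [hae] with x hx
  have h1 : Tendsto (fun n => F (ns n) x) atTop (𝓝 (f x)) :=
    tendsto_const_nhds.congr' ((hns.tendsto_atTop.eventually (hFf x)).mono fun _ h => h.symm)
  simpa using h1.sub hx

/-- For the nucleus `x' j` of the cell of `x`, the value `v n j` is at least as close to `g (x' j)`
as a prototype near `z` is. Hence `dist z (g (x' j))` is paid twice in the triangle inequality,
which explains the factor 2 and the choices `η / 4` and `η / 2`. -/
lemma eventually_dist_cellwise_le {𝓧 𝓨 : Type*} [MetricSpace 𝓧] [NormedAddCommGroup 𝓨]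
    {x' : ℕ → 𝓧} {y' : ℕ → 𝓨} {k : ℕ → ℕ} (hk : Tendsto k atTop atTop) {g : 𝓧 → 𝓨}
    (hg : Continuous g) {v : (n : ℕ) → Fin (k n) → 𝓨}
    (hv : ∀ n (j : Fin (k n)) (i : Fin n), dist (g (x' j)) (v n j) ≤ dist (g (x' j)) (y' i))
    {x : 𝓧} {z : 𝓨} (hx : ∀ ε > 0, ∃ j, dist x (x' j) < ε) (hz : ∀ ε > 0, ∃ i, dist z (y' i) < ε)
    {η : ℝ} (hη : 0 < η) :
    ∀ᶠ n in atTop, dist z (cellwise (fun j : Fin (k n) => x' j) (v n) x) ≤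
      2 * dist (g x) z + η := by
  obtain ⟨δ, hδ, hgδ⟩ := Metric.continuous_iff.1 hg x (η / 4) (by positivity)
  obtain ⟨j₀, hj₀⟩ := hx δ hδ
  obtain ⟨i₀, hi₀⟩ := hz (η / 2) (by positivity)
  filter_upwards [hk.eventually_gt_atTop j₀, eventually_gt_atTop i₀] with n hkn hn
  obtain ⟨j, hj⟩ := exists_mem_voronoiCell (j₀.zero_le.trans_lt hkn) (fun j : Fin (k n) => x' j) x
  rw [cellwise_of_mem _ hj]
  have h1 : dist (x' j) x < δ := by
    rw [dist_comm]
    exact (hj.1 ⟨j₀, hkn⟩).trans_lt hj₀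
  have h2 := hgδ _ h1
  have h3 := hv n j ⟨i₀, hn⟩
  have h4 := dist_triangle z (g (x' j)) (v n j)
  have h5 := dist_triangle (g (x' j)) z (y' i₀)
  have h6 := dist_triangle (g (x' j)) (g x) z
  rw [dist_comm z (g (x' j))] at h4
  simp only at h3
  linarith

end Approximation

/-! ### Risk comparisons. -/

section Risk

variable {𝓧 𝓨 : Type*} [MeasurableSpace 𝓧] [MeasurableSpace 𝓨]
  {ν : Measure (𝓧 × 𝓨)} [IsProbabilityMeasure ν] {ℓ : 𝓨 → 𝓨 → ℝ} {L : ℝ}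

lemma integrable_loss (hℓ_meas : Measurable (Function.uncurry ℓ))
    (hℓ_nonneg : ∀ y y', 0 ≤ ℓ y y') (hℓ_bdd : ∀ y y', ℓ y y' ≤ L) {f : 𝓧 → 𝓨}
    (hf : Measurable f) : Integrable (fun p : 𝓧 × 𝓨 => ℓ p.2 (f p.1)) ν :=
  Integrable.of_mem_Icc 0 L
    (hℓ_meas.comp (measurable_snd.prodMk (hf.comp measurable_fst))).aemeasurable
    (ae_of_all _ fun _ => ⟨hℓ_nonneg _ _, hℓ_bdd _ _⟩)

/-- Disintegrate both risks over the first marginal and integrate the pointwise minimality. -/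
lemma IsCondFrechetMean.risk_le [StandardBorelSpace 𝓨] [Nonempty 𝓨]
    (hℓ_meas : Measurable (Function.uncurry ℓ))
    (hℓ_nonneg : ∀ y y', 0 ≤ ℓ y y') (hℓ_bdd : ∀ y y', ℓ y y' ≤ L)
    {m f : 𝓧 → 𝓨} (hm : IsCondFrechetMean ν ℓ m) (hf : Measurable f) :
    risk ν ℓ m ≤ risk ν ℓ f := by
  have hi : ∀ {f : 𝓧 → 𝓨}, Measurable f → Integrable (fun p : 𝓧 × 𝓨 => ℓ p.2 (f p.1)) ν :=
    fun hf => integrable_loss hℓ_meas hℓ_nonneg hℓ_bdd hf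
  have hi' : ∀ {f : 𝓧 → 𝓨}, Measurable f →
      Integrable (fun x => ∫ y, ℓ y (f x) ∂(ν.condKernel x)) ν.fst := fun hf => by
    have := hi hf
    rw [← ν.disintegrate ν.condKernel] at this
    exact this.integral_compProd
  unfold risk
  rw [← Measure.integral_condKernel (hi hm.1), ← Measure.integral_condKernel (hi hf)]
  refine integral_mono_ae (hi' hm.1) (hi' hf) ?_
  filter_upwards [hm.2] with x hx using hx (f x)

lemma risk_le_risk_add [PseudoMetricSpace 𝓨] [OpensMeasurableSpace 𝓨] [SecondCountableTopology 𝓨]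
    (hℓ_meas : Measurable (Function.uncurry ℓ))
    (hℓ_nonneg : ∀ y y', 0 ≤ ℓ y y') (hℓ_bdd : ∀ y y', ℓ y y' ≤ L)
    {c : ℝ} (hc : 0 ≤ c) (hℓ_tri : ∀ y y' y'', |ℓ y y' - ℓ y y''| ≤ c * ℓ y' y'')
    {ψ : ℝ → ℝ} (hψ : Continuous ψ) (hψL : ∀ r, ψ r ≤ L) (hℓψ : ∀ y y', ℓ y y' ≤ ψ (dist y y'))
    {f m : 𝓧 → 𝓨} (hf : Measurable f) (hm : Measurable m) :
    risk ν ℓ f ≤ risk ν ℓ m + c * ∫ x, ψ (dist (m x) (f x)) ∂ν.fst := by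
  have hmeas : Measurable fun x => ψ (dist (m x) (f x)) := hψ.measurable.comp (hm.dist hf)
  have hint : Integrable (fun p : 𝓧 × 𝓨 => ψ (dist (m p.1) (f p.1))) ν :=
    Integrable.of_mem_Icc 0 L (hmeas.comp measurable_fst).aemeasurable
      (ae_of_all _ fun _ => ⟨(hℓ_nonneg _ _).trans (hℓψ _ _), hψL _⟩)
  have hmap : ∫ x, ψ (dist (m x) (f x)) ∂ν.fst = ∫ p, ψ (dist (m p.1) (f p.1)) ∂ν :=
    integral_map measurable_fst.aemeasurable hmeas.aestronglyMeasurable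
  have him := integrable_loss (ν := ν) hℓ_meas hℓ_nonneg hℓ_bdd hm
  rw [hmap, risk, risk, ← integral_const_mul, ← integral_add him (hint.const_mul c)]
  refine integral_mono (integrable_loss hℓ_meas hℓ_nonneg hℓ_bdd hf)
    (him.add (hint.const_mul c)) fun p => ?_
  have h1 := (abs_le.1 (hℓ_tri p.2 (m p.1) (f p.1))).1
  have h2 := mul_le_mul_of_nonneg_left (hℓψ (m p.1) (f p.1)) hc
  simp only
  linarith

end Risk

/-! ### Cellwise functions of nearly optimal risk. -/

section Approximation

lemma tendsto_integral_comp_of_tendsto_ae {𝓧 : Type*} [MeasurableSpace 𝓧] {μ : Measure 𝓧}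
    [IsFiniteMeasure μ] {ψ : ℝ → ℝ} (hψ : Continuous ψ) {L : ℝ} (hψnn : ∀ r, 0 ≤ ψ r)
    (hψL : ∀ r, ψ r ≤ L) {h : ℕ → 𝓧 → ℝ} {h₀ : 𝓧 → ℝ} (hh : ∀ n, Measurable (h n))
    (hh₀ : ∀ᵐ x ∂μ, Tendsto (fun n => h n x) atTop (𝓝 (h₀ x))) :
    Tendsto (fun n => ∫ x, ψ (h n x) ∂μ) atTop (𝓝 (∫ x, ψ (h₀ x) ∂μ)) := by
  refine tendsto_integral_of_dominated_convergence (fun _ => L)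
    (fun n => (hψ.measurable.comp (hh n)).aestronglyMeasurable) (integrable_const _)
    (fun n => ae_of_all _ fun x => ?_) ?_
  · rw [Real.norm_of_nonneg (hψnn _)]
    exact hψL _
  · filter_upwards [hh₀] with x hx using (hψ.tendsto _).comp hx

lemma exists_continuous_integral_comp_dist_lt {𝓧 𝓨 : Type*} [MetricSpace 𝓧] [MeasurableSpace 𝓧]
    [BorelSpace 𝓧] [NormedAddCommGroup 𝓨] [NormedSpace ℝ 𝓨] [SecondCountableTopology 𝓨]
    [MeasurableSpace 𝓨] [BorelSpace 𝓨] (μ : Measure 𝓧) [IsFiniteMeasure μ]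
    {ψ : ℝ → ℝ} (hψ : Continuous ψ) {L : ℝ} (hψ0 : ψ 0 = 0) (hψnn : ∀ r, 0 ≤ ψ r)
    (hψL : ∀ r, ψ r ≤ L) {m : 𝓧 → 𝓨} (hm : Measurable m) {δ : ℝ} (hδ : 0 < δ) :
    ∃ g : 𝓧 → 𝓨, Continuous g ∧ ∫ x, ψ (2 * dist (g x) (m x)) ∂μ < δ := by
  obtain ⟨g, hg, hgm⟩ := exists_seq_continuous_tendsto_ae μ hm
  have hlim : Tendsto (fun n => ∫ x, ψ (2 * dist (g n x) (m x)) ∂μ) atTop (𝓝 (∫ _, ψ 0 ∂μ)) := by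
    refine tendsto_integral_comp_of_tendsto_ae hψ hψnn hψL (h₀ := fun _ => 0)
      (fun n => ((hg n).measurable.dist hm).const_mul 2) ?_
    filter_upwards [hgm] with x hx
    simpa using (tendsto_iff_dist_tendsto_zero.1 hx).const_mul 2
  rw [hψ0, integral_zero] at hlim
  obtain ⟨n, hn⟩ := (hlim.eventually (gt_mem_nhds hδ)).exists
  exact ⟨g n, hg n, hn⟩

lemma exists_cell_values {𝓧 𝓨 : Type*} [PseudoMetricSpace 𝓨] [Nonempty 𝓨] (g : 𝓧 → 𝓨)
    (x' : ℕ → 𝓧) (y' : ℕ → 𝓨) (k : ℕ → ℕ) :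
    ∃ v : (n : ℕ) → Fin (k n) → 𝓨,
      (∀ n (j : Fin (k n)) (i : Fin n), dist (g (x' j)) (v n j) ≤ dist (g (x' j)) (y' i)) ∧
      ∀ n, 0 < n → ∃ φ : Fin (k n) → Fin n, v n = fun j => y' (φ j) := by
  have h : ∀ n (j : Fin (k n)), ∃ w : 𝓨,
      (∀ i : Fin n, dist (g (x' j)) w ≤ dist (g (x' j)) (y' i)) ∧
        (0 < n → ∃ i : Fin n, w = y' i) := by
    intro n j
    rcases Nat.eq_zero_or_pos n with rfl | hn
    -- With `n = 0` there is no prototype to choose, and any value satisfies the empty condition.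
    · exact ⟨Classical.arbitrary 𝓨, fun i => i.elim0, fun h => absurd h (lt_irrefl _)⟩
    · have : Nonempty (Fin n) := ⟨⟨0, hn⟩⟩
      obtain ⟨i, hi⟩ := Finite.exists_min fun i : Fin n => dist (g (x' j)) (y' i)
      exact ⟨y' i, hi, fun _ => ⟨i, rfl⟩⟩
  choose v hvle hvmem using h
  refine ⟨v, hvle, fun n hn => ?_⟩
  choose φ hφ using fun j => hvmem n j hn
  exact ⟨φ, funext hφ⟩

lemma eventually_exists_risk_cellwise_le_of_loss_le {𝓧 𝓨 : Type*}
    [MetricSpace 𝓧] [SecondCountableTopology 𝓧] [MeasurableSpace 𝓧] [BorelSpace 𝓧]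
    [NormedAddCommGroup 𝓨] [NormedSpace ℝ 𝓨] [SecondCountableTopology 𝓨]
    [MeasurableSpace 𝓨] [BorelSpace 𝓨]
    {ν : Measure (𝓧 × 𝓨)} [IsProbabilityMeasure ν] {ℓ : 𝓨 → 𝓨 → ℝ} {L : ℝ}
    (hℓ_meas : Measurable (Function.uncurry ℓ))
    (hℓ_nonneg : ∀ y y', 0 ≤ ℓ y y') (hℓ_bdd : ∀ y y', ℓ y y' ≤ L)
    {c : ℝ} (hc : 0 ≤ c) (hℓ_tri : ∀ y y' y'', |ℓ y y' - ℓ y y''| ≤ c * ℓ y' y'')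
    {ψ : ℝ → ℝ} (hψc : Continuous ψ) (hψmono : Monotone ψ) (hψ0 : ψ 0 = 0)
    (hψnn : ∀ r, 0 ≤ ψ r) (hψL : ∀ r, ψ r ≤ L) (hℓψ : ∀ y y', ℓ y y' ≤ ψ (dist y y'))
    {m : 𝓧 → 𝓨} (hm : Measurable m) {x' : ℕ → 𝓧} {y' : ℕ → 𝓨}
    (hx' : ∀ᵐ x ∂ν.fst, ∀ ε > 0, ∃ j, dist x (x' j) < ε)
    (hy' : ∀ᵐ x ∂ν.fst, ∀ ε > 0, ∃ i, dist (m x) (y' i) < ε)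
    {k : ℕ → ℕ} (hk : Tendsto k atTop atTop) {ε : ℝ} (hε : 0 < ε) :
    ∀ᶠ n in atTop, ∃ φ : Fin (k n) → Fin n,
      risk ν ℓ (cellwise (fun j : Fin (k n) => x' j) (fun j => y' (φ j))) ≤ risk ν ℓ m + ε := by
  have hψi : ∀ {h : 𝓧 → ℝ}, Measurable h → Integrable (fun x => ψ (h x)) ν.fst := fun hh =>
    Integrable.of_mem_Icc 0 L (hψc.measurable.comp hh).aemeasurable
      (ae_of_all _ fun _ => ⟨hψnn _, hψL _⟩)
  -- Dividing by `c + 1` covers `c = 0`.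
  have hδ : 0 < ε / (c + 1) := by positivity
  obtain ⟨g, hg, hgδ⟩ := exists_continuous_integral_comp_dist_lt ν.fst hψc hψ0 hψnn hψL hm hδ
  obtain ⟨v, hvle, hvmem⟩ := exists_cell_values g x' y' k
  obtain ⟨F, hF⟩ : ∃ F : ℕ → 𝓧 → 𝓨, ∀ n, F n = cellwise (fun j : Fin (k n) => x' j) (v n) :=
    ⟨_, fun _ => rfl⟩
  have hFm : ∀ n, Measurable (F n) := fun n => by
    rw [hF]
    exact measurable_cellwise_apply _ _
  have hgm : Measurable fun x => 2 * dist (g x) (m x) := (hg.measurable.dist hm).const_mul 2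
  -- Only an asymptotic upper bound on `dist (m x) (F n x)` is known. Its maximum with `2 * dist (g
  -- x) (m x)` does converge, so dominated convergence applies, and monotonicity of `ψ` transfers
  -- the bound.
  have hmax : ∀ n, Measurable fun x => max (dist (m x) (F n x)) (2 * dist (g x) (m x)) :=
    fun n => (hm.dist (hFm n)).max hgm
  have hae : ∀ᵐ x ∂ν.fst, Tendsto (fun n => max (dist (m x) (F n x)) (2 * dist (g x) (m x))) atTop
      (𝓝 (2 * dist (g x) (m x))) := by
    filter_upwards [hx', hy'] with x hx hy
    rw [Metric.tendsto_nhds]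
    intro η hη
    filter_upwards [eventually_dist_cellwise_le hk hg hvle hx hy (half_pos hη)] with n hn
    rw [← hF] at hn
    rw [Real.dist_eq, abs_of_nonneg (sub_nonneg.2 (le_max_right _ _)), sub_lt_iff_lt_add']
    exact max_lt (hn.trans_lt (by linarith)) (by linarith)
  have hconv := tendsto_integral_comp_of_tendsto_ae hψc hψnn hψL hmax hae
  filter_upwards [hconv.eventually (gt_mem_nhds hgδ), eventually_gt_atTop 0] with n hn hn0
  obtain ⟨φ, hφ⟩ := hvmem n hn0
  refine ⟨φ, ?_⟩
  rw [← hφ, ← hF]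
  refine (risk_le_risk_add hℓ_meas hℓ_nonneg hℓ_bdd hc hℓ_tri hψc hψL hℓψ (hFm n) hm).trans ?_
  have h1 : ∫ x, ψ (dist (m x) (F n x)) ∂ν.fst ≤ ε / (c + 1) :=
    (integral_mono (hψi (hm.dist (hFm n))) (hψi (hmax n))
      fun x => hψmono (le_max_left _ _)).trans hn.le
  have h2 : c * ∫ x, ψ (dist (m x) (F n x)) ∂ν.fst ≤ ε := by
    refine (mul_le_mul_of_nonneg_left h1 hc).trans ?_
    rw [mul_div_assoc', div_le_iff₀ (by positivity)]
    linarith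
  linarith

lemma eventually_exists_risk_cellwise_le {𝓧 𝓨 : Type*}
    [MetricSpace 𝓧] [SecondCountableTopology 𝓧] [MeasurableSpace 𝓧] [BorelSpace 𝓧]
    [NormedAddCommGroup 𝓨] [NormedSpace ℝ 𝓨] [SecondCountableTopology 𝓨]
    [MeasurableSpace 𝓨] [BorelSpace 𝓨]
    {ν : Measure (𝓧 × 𝓨)} [IsProbabilityMeasure ν] {ℓ : 𝓨 → 𝓨 → ℝ} {L : ℝ}
    (hℓ_meas : Measurable (Function.uncurry ℓ))
    (hℓ_nonneg : ∀ y y', 0 ≤ ℓ y y') (hℓ_bdd : ∀ y y', ℓ y y' ≤ L)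
    {c : ℝ} (hc : 0 ≤ c) (hℓ_tri : ∀ y y' y'', |ℓ y y' - ℓ y y''| ≤ c * ℓ y' y'')
    {α : ℝ} (hα : 0 < α) (hℓ_pow : ∀ y y', ℓ y y' ≤ dist y y' ^ α)
    {m : 𝓧 → 𝓨} (hm : Measurable m) {x' : ℕ → 𝓧} {y' : ℕ → 𝓨}
    (hx' : ∀ᵐ x ∂ν.fst, ∀ ε > 0, ∃ j, dist x (x' j) < ε)
    (hy' : ∀ᵐ x ∂ν.fst, ∀ ε > 0, ∃ i, dist (m x) (y' i) < ε)
    {k : ℕ → ℕ} (hk : Tendsto k atTop atTop) {ε : ℝ} (hε : 0 < ε) :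
    ∀ᶠ n in atTop, ∃ φ : Fin (k n) → Fin n,
      risk ν ℓ (cellwise (fun j : Fin (k n) => x' j) (fun j => y' (φ j))) ≤ risk ν ℓ m + ε := by
  have hL : 0 ≤ L := (hℓ_nonneg 0 0).trans (hℓ_bdd 0 0)
  -- The cap at `L` supplies the dominating constant; the positive part makes `ψ` monotone and
  -- continuous on the whole line.
  let ψ : ℝ → ℝ := fun r => min L ((max r 0) ^ α)
  have hψc : Continuous ψ := continuous_const.min
    ((continuous_id.max continuous_const).rpow_const fun _ => Or.inr hα.le)
  have hψ0 : ψ 0 = 0 := by simp [ψ, Real.zero_rpow hα.ne', hL]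
  have hψL : ∀ r, ψ r ≤ L := fun r => min_le_left _ _
  have hψnn : ∀ r, 0 ≤ ψ r := fun r => le_min hL (Real.rpow_nonneg (le_max_right _ _) _)
  have hψmono : Monotone ψ := fun r s hrs => by
    simp only [ψ]
    gcongr
  have hℓψ : ∀ y y', ℓ y y' ≤ ψ (dist y y') := fun y y' =>
    le_min (hℓ_bdd _ _) (by rw [max_eq_left dist_nonneg]; exact hℓ_pow _ _)
  exact eventually_exists_risk_cellwise_le_of_loss_le hℓ_meas hℓ_nonneg hℓ_bdd hc hℓ_tri
    hψc hψmono hψ0 hψnn hψL hℓψ hm hx' hy' hk hε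

end Approximation

end ProtoNN

/-! ### Estimation and approximation combined. -/

theorem theorem2
    {𝓧 𝓨 Ω : Type*}
    -- `𝓧` is a separable metric space, `𝓨` a separable Banach space
    [MetricSpace 𝓧] [SecondCountableTopology 𝓧] [MeasurableSpace 𝓧] [BorelSpace 𝓧]
    [NormedAddCommGroup 𝓨] [NormedSpace ℝ 𝓨] [CompleteSpace 𝓨] [SecondCountableTopology 𝓨]
    [MeasurableSpace 𝓨] [BorelSpace 𝓨]
    [MeasurableSpace Ω] (P : Measure Ω) [IsProbabilityMeasure P]
    -- the law of `(X, Y)`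
    (ν : Measure (𝓧 × 𝓨)) [IsProbabilityMeasure ν]
    -- the loss
    (ℓ : 𝓨 → 𝓨 → ℝ) (hℓ_meas : Measurable (Function.uncurry ℓ))
    (hℓ_nonneg : ∀ y y', 0 ≤ ℓ y y')
    (L : ℝ) (hℓ_bdd : ∀ y y', ℓ y y' ≤ L)
    (c : ℝ) (hℓ_tri : ∀ y y' y'', |ℓ y y' - ℓ y y''| ≤ c * ℓ y' y'')
    (α : ℝ) (hα : 0 < α) (hℓ_pow : ∀ y y', ℓ y y' ≤ dist y y' ^ α)
    -- the conditional Fréchet mean, with values in the support of the law of `Y`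
    (mFr : 𝓧 → 𝓨) (hmFr : ProtoNN.IsCondFrechetMean ν ℓ mFr)
    (hmFr_supp : ∀ᵐ x ∂ν.fst, mFr x ∈ ν.snd.support)
    -- the labeled sample
    (X : ℕ → Ω → 𝓧) (Y : ℕ → Ω → 𝓨)
    (hXY_law : ∀ i, HasLaw (fun ω => (X i ω, Y i ω)) ν P)
    (hXY_indep : iIndepFun (fun i ω => (X i ω, Y i ω)) P)
    -- the unlabeled prototypes
    (X' : ℕ → Ω → 𝓧) (hX'_law : ∀ j, HasLaw (X' j) ν.fst P) (hX'_indep : iIndepFun X' P)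
    -- the output prototypes
    (Y' : ℕ → Ω → 𝓨) (hY'_law : ∀ i, HasLaw (Y' i) ν.snd P) (hY'_indep : iIndepFun Y' P)
    -- all prototypes together are independent of the labeled sample
    (h_indep : IndepFun (fun ω (i : ℕ) => (X i ω, Y i ω))
      (fun ω => (fun j : ℕ => X' j ω, fun i : ℕ => Y' i ω)) P)
    -- ties have probability zero
    (h_ties : ∀ i j : ℕ, i ≠ j →
      ∀ᵐ ω ∂P, ∀ᵐ x ∂ν.fst, dist x (X' i ω) ≠ dist x (X' j ω))
    -- the number of cells
    (k : ℕ → ℕ) (hk : Tendsto k atTop atTop)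
    (hk_log : Tendsto (fun n : ℕ => (k n : ℝ) * Real.log n / n) atTop (𝓝 0))
    -- the estimate, with any choice among the minimizers
    (m : ℕ → Ω → 𝓧 → 𝓨)
    (hm : ∀ n, 1 ≤ n → ∀ ω, ProtoNN.IsEstimate ℓ
      (fun i : Fin n => X i ω) (fun i : Fin n => Y i ω)
      (fun j : Fin (k n) => X' j ω) (fun i : Fin n => Y' i ω) (m n ω)) :
    ∀ᵐ ω ∂P, Tendsto (fun n => ProtoNN.risk ν ℓ (m n ω)) atTop (𝓝 (ProtoNN.risk ν ℓ mFr)) := by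
  have hL : 0 ≤ L := (hℓ_nonneg 0 0).trans (hℓ_bdd 0 0)
  -- The absolute value gives a nonnegative constant whatever the sign of `c`; likewise `L + 1`
  -- below is positive even if `L = 0`.
  have hc : ∀ y y' y'', |ℓ y y' - ℓ y y''| ≤ |c| * ℓ y' y'' := fun y y' y'' =>
    (hℓ_tri y y' y'').trans (mul_le_mul_of_nonneg_right (le_abs_self c) (hℓ_nonneg _ _))
  filter_upwards [ProtoNN.ae_eventually_forall_abs_sum_sub_risk_lt hℓ_meas hℓ_nonneg
      (L := L + 1) (by linarith) (fun y y' => (hℓ_bdd y y').trans (by linarith)) hXY_law hXY_indep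
      (fun j => (hX'_law j).aemeasurable) (fun i => (hY'_law i).aemeasurable) h_indep hk_log,
    ProtoNN.ae_forall_mem_support_exists_dist_lt hX'_law hX'_indep,
    ProtoNN.ae_forall_mem_support_exists_dist_lt hY'_law hY'_indep] with ω hunif hX'd hY'd
  have happrox := fun ε (hε : (0 : ℝ) < ε) => ProtoNN.eventually_exists_risk_cellwise_le
    (ν := ν) hℓ_meas hℓ_nonneg hℓ_bdd (abs_nonneg c) hc hα hℓ_pow hmFr.1
    (x' := fun j => X' j ω) (y' := fun i => Y' i ω)
    (by filter_upwards [Measure.support_mem_ae (μ := ν.fst)] with x hx using hX'd x hx)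
    (by filter_upwards [hmFr_supp] with x hx using hY'd _ hx) hk hε
  rw [Metric.tendsto_nhds]
  intro ε hε
  filter_upwards [hunif (ε / 4) (by positivity), happrox (ε / 4) (by positivity),
    hk.eventually_gt_atTop 0, eventually_ge_atTop 1] with n hn ⟨ψ, hψ⟩ hkn hn1
  obtain ⟨φ, hφ, hmin⟩ := (hm n hn1 ω).exists_eq_cellwise hkn
  have hmeas : Measurable (m n ω) := by
    rw [hφ]
    exact ProtoNN.measurable_cellwise_apply _ _
  have hlow := hmFr.risk_le hℓ_meas hℓ_nonneg hℓ_bdd hmeas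
  have h1 := (abs_lt.1 (hn φ)).1
  have h2 := (abs_lt.1 (hn ψ)).2
  have h3 := hmin ψ
  have hn0 : (0 : ℝ) < n := by exact_mod_cast hn1
  -- Two deviations and one approximation error, each at most `ε / 4`, give an excess risk below
  -- `ε`: pass from the risk of the estimate to its empirical risk, compare with `ψ`, and return to
  -- the risk.
  have hup : ProtoNN.risk ν ℓ (m n ω) < ProtoNN.risk ν ℓ mFr + ε := by
    rw [hφ]
    refine lt_of_mul_lt_mul_left ?_ hn0.le
    have h4 := mul_le_mul_of_nonneg_left hψ hn0.le
    have h5 : 0 < n * ε := by positivity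
    simp only [Function.comp_def] at h3 ⊢
    linarith
  rw [Real.dist_eq, abs_lt]
  constructor <;> linarith
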